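/- Conventions: for a one-form $\alpha$, $d\alpha(X,Y)=\tfrac12\big(X(\alpha(Y))-Y(\alpha(X))-\alpha([X,Y])\big)$, as is usual in contact metric geometry; the Riemann curvature is $R(X,Y)Z=\nabla_X\nabla_YZ-\nabla_Y\nabla_XZ-\nabla_{[X,Y]}Z$ and $\mathrm{Ric}(Y,Z)=\mathrm{tr}\big(X\mapsto R(X,Y)Z\big)$. A contact metric manifold $(M,\eta,g,\phi)$ is a non-empty smooth manifold $M$ (without boundary) of dimension $2n+1$, $n\ge 0$, with a one-form $\eta$ such that $\eta\wedge(d\eta)^n$ vanishes nowhere, a Riemannian metric $g$ and a $(1,1)$-tensor field $\phi$ such that, for all vector fields $X,Y$ on $M$, $$g(X,\xi)=\eta(X),\qquad \phi^2=-I+\eta\otimes\xi,\qquad d\eta(X,Y)=g(X,\phi Y),$$ where $\xi$ is the Reeb vector field, determined by $\eta(\xi)=1$ and $d\eta(\xi,\cdot)=0$. Its metric symplectization is $(M\times\mathbb R,\omega,\bar g,J)$, where $t$ is the coordinate on $\mathbb R$, $\omega=d(e^{2t}\eta)$, $J$ is an almost complex structure and $\bar g$ a Riemannian metric on $M\times\mathbb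 R$ with $\bar g(X,JY)=\omega(X,Y)$ for all vector fields $X,Y$ on $M\times\mathbb R$, such that $\partial_t$ has unit $\bar g$-length and is $\bar g$-orthogonal to every slice $M\times\{t_0\}$, and $J$ agrees with $\phi$ on the contact distribution $\ker\eta$ of every slice. (These conditions determine $\bar g$ and $J$ uniquely; explicitly $\bar g=dt^2+e^{2t}g+e^{2t}(e^{2t}-1)\,\eta\otimes\eta$.) **Corollary.** Let $(M,\eta,g,\phi)$ be a contact metric manifold of dimension $2n+1$, and let $(M\times\mathbb R,\omega,\bar g,J)$ be its metric symplectization, with Ricci tensor $\overline{\mathrm{Ric}}$. Then $\bar g$ does not have non-negative Ricci curvature, that is, $\overline{\mathrm{Ric}}(v,v)<0$ for some tangent vector $v$ of $M\times\mathbb R$. Moreover, at every point of $M\times\mathbb R$, $$\overline{\mathrm{Ric}}(\partial_t,\partial_t)=-(2n+4).$$ -/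

import Mathlib

open Bundle Set Filter Manifold
open scoped Topology ContDiff

noncomputable section

namespace ContactMetric

/-! ### Tensors in charts, the Ricci tensor, the exterior derivative of a one-form

Here `M` is a manifold without boundary. Mathlib identifies `TangentSpace I p` with the model
vector space `E` through the chart `extChartAt I p`, whose derivative at `p` is the identity. -/

section Charts

variable {E : Type*} [NormedAddCommGroup E] [NormedSpace ℝ E]
  {H : Type*} [TopologicalSpace H] (I : ModelWithCorners ℝ E H)
  {M : Type*} [TopologicalSpace M] [ChartedSpace H M]

/-- The derivative at `y` of the inverse of the chart at `p`: it sends a constant coordinate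
vector field to its value at the point with coordinates `y`. -/
def chartVec (p : M) (y : E) : E →L[ℝ] TangentSpace I ((extChartAt I p).symm y) :=
  mfderiv 𝓘(ℝ, E) I (extChartAt I p).symm y

/-- A one-form, read in the chart at `p`. -/
def chartOneForm (α : ∀ x : M, TangentSpace I x →L[ℝ] ℝ) (p : M) (y : E) : E →L[ℝ] ℝ :=
  (α ((extChartAt I p).symm y)).comp (chartVec I p y)

/-- The exterior derivative of a one-form at `p`, computed in the chart at `p`, with the
normalization `dα(X, Y) = ½ (X(α(Y)) - Y(α(X)) - α([X, Y]))` that is customary in contact metric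
geometry. -/
def extDerivOneForm (α : ∀ x : M, TangentSpace I x →L[ℝ] ℝ) (p : M)
    (u v : TangentSpace I p) : ℝ :=
  (1 / 2) * (fderiv ℝ (chartOneForm I α p) (extChartAt I p p) u v
    - fderiv ℝ (chartOneForm I α p) (extChartAt I p p) v u)

/-- The components `G(y)(v, w)` of a symmetric 2-tensor in the chart at `p`. -/
def chartTensor (G : ∀ x : M, TangentSpace I x →L[ℝ] TangentSpace I x →L[ℝ] ℝ) (p : M) (y : E) :
    E →L[ℝ] E →L[ℝ] ℝ :=
  (ContinuousLinearMap.precomp ℝ (chartVec I p y)).comp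
    ((G ((extChartAt I p).symm y)).comp (chartVec I p y))

end Charts

section LocalGeometry

variable {E : Type*} [NormedAddCommGroup E] [NormedSpace ℝ E]

/-- The Christoffel symbols of the first kind of a metric `G` on an open set of `E`, as the
covector `z ↦ ½ (∂_v G(w, z) + ∂_w G(v, z) - ∂_z G(v, w))`. -/
def christoffelLower (G : E → E →L[ℝ] E →L[ℝ] ℝ) (y v w : E) : E →L[ℝ] ℝ :=
  (1 / 2 : ℝ) • (fderiv ℝ G y v w + fderiv ℝ G y w v - ((fderiv ℝ G y).flip v).flip w)

/-- The Christoffel symbols `Γ(v, w) = Γᵏᵢⱼ vⁱ wʲ ∂ₖ` of the Levi-Civita connection of `G`. -/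
def christoffel (G : E → E →L[ℝ] E →L[ℝ] ℝ) (y v w : E) : E :=
  (G y).inverse (christoffelLower G y v w)

/-- The Riemann curvature `R(u, v) w = ∇ᵤ∇ᵥ w - ∇ᵥ∇ᵤ w` of `G` at `y`, for constant coordinate
vector fields `u`, `v`, `w`. -/
def riemannCurvature (G : E → E →L[ℝ] E →L[ℝ] ℝ) (y u v w : E) : E :=
  fderiv ℝ (fun z => christoffel G z v w) y u - fderiv ℝ (fun z => christoffel G z u w) y v
    + christoffel G y u (christoffel G y v w) - christoffel G y v (christoffel G y u w)

/-- The Ricci curvature `Ric(v, w) = trace (u ↦ R(u, v) w)` of `G` at `y`, the trace being taken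
in a basis of `E`. -/
def ricciLocal [FiniteDimensional ℝ E] (G : E → E →L[ℝ] E →L[ℝ] ℝ) (y v w : E) : ℝ :=
  ∑ i, (Module.finBasis ℝ E).coord i (riemannCurvature G y (Module.finBasis ℝ E i) v w)

end LocalGeometry

/-- The Ricci tensor at `p` of a Riemannian metric, computed in the chart at `p`. -/
def ricci {E : Type*} [NormedAddCommGroup E] [NormedSpace ℝ E] [FiniteDimensional ℝ E]
    {H : Type*} [TopologicalSpace H] {I : ModelWithCorners ℝ E H}
    {M : Type*} [TopologicalSpace M] [ChartedSpace H M] [IsManifold I ∞ M]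
    (g : ContMDiffRiemannianMetric I ∞ E (fun x : M => TangentSpace I x))
    (p : M) (v w : TangentSpace I p) : ℝ :=
  ricciLocal (chartTensor I g.inner p) (extChartAt I p p) v w

/-! ### Contact metric structures -/

/-- The `(2n+1)`-linear form `α ∧ βⁿ` for a covector `α` and an alternating 2-form `β`, up to a
positive normalizing constant. -/
def wedgePow {V : Type*} (n : ℕ) (α : V → ℝ) (β : V → V → ℝ) (v : Fin (2 * n + 1) → V) : ℝ :=
  ∑ σ : Equiv.Perm (Fin (2 * n + 1)), ((Equiv.Perm.sign σ : ℤ) : ℝ) * α (v (σ 0)) *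
    ∏ i : Fin n, β (v (σ ⟨2 * i + 1, by omega⟩)) (v (σ ⟨2 * i + 2, by omega⟩))

section Contact

variable {E : Type*} [NormedAddCommGroup E] [NormedSpace ℝ E]

/-- A contact metric structure `(η, g, φ)`, with Reeb vector field `ξ`, on a manifold `M` of
dimension `2n+1`. -/
structure ContactMetricStructure (n : ℕ) (E : Type*) [NormedAddCommGroup E] [NormedSpace ℝ E]
    (M : Type*) [TopologicalSpace M] [ChartedSpace E M] [IsManifold 𝓘(ℝ, E) ∞ M] where
  /-- the contact form -/
  η : ∀ x : M, TangentSpace 𝓘(ℝ, E) x →L[ℝ] ℝ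
  /-- the Reeb vector field -/
  ξ : ∀ x : M, TangentSpace 𝓘(ℝ, E) x
  /-- the Riemannian metric -/
  g : ContMDiffRiemannianMetric 𝓘(ℝ, E) ∞ E (fun x : M => TangentSpace 𝓘(ℝ, E) x)
  /-- the `(1,1)`-tensor field -/
  φ : ∀ x : M, TangentSpace 𝓘(ℝ, E) x →L[ℝ] TangentSpace 𝓘(ℝ, E) x
  contMDiff_η : ContMDiff 𝓘(ℝ, E) (𝓘(ℝ, E).prod 𝓘(ℝ, E →L[ℝ] ℝ)) ∞
    (fun x : M => TotalSpace.mk' (E →L[ℝ] ℝ)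
      (E := fun x : M => TangentSpace 𝓘(ℝ, E) x →L[ℝ] (Trivial M ℝ x)) x (η x))
  contMDiff_ξ : ContMDiff 𝓘(ℝ, E) 𝓘(ℝ, E).tangent ∞
    (fun x : M => (⟨x, ξ x⟩ : TangentBundle 𝓘(ℝ, E) M))
  contMDiff_φ : ContMDiff 𝓘(ℝ, E) (𝓘(ℝ, E).prod 𝓘(ℝ, E →L[ℝ] E)) ∞
    (fun x : M => TotalSpace.mk' (E →L[ℝ] E)
      (E := fun x : M => TangentSpace 𝓘(ℝ, E) x →L[ℝ] TangentSpace 𝓘(ℝ, E) x) x (φ x))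
  /-- the contact condition `η ∧ (dη)ⁿ ≠ 0` at every point -/
  contact : ∀ x : M, ∃ v : Fin (2 * n + 1) → TangentSpace 𝓘(ℝ, E) x,
    wedgePow n (η x) (extDerivOneForm 𝓘(ℝ, E) η x) v ≠ 0
  η_ξ : ∀ x : M, η x (ξ x) = 1
  dη_ξ : ∀ (x : M) (X : TangentSpace 𝓘(ℝ, E) x), extDerivOneForm 𝓘(ℝ, E) η x (ξ x) X = 0
  g_ξ : ∀ (x : M) (X : TangentSpace 𝓘(ℝ, E) x), g.inner x X (ξ x) = η x X
  φ_sq : ∀ (x : M) (X : TangentSpace 𝓘(ℝ, E) x), φ x (φ x X) = -X + η x X • ξ x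
  dη_eq : ∀ (x : M) (X Y : TangentSpace 𝓘(ℝ, E) x),
    extDerivOneForm 𝓘(ℝ, E) η x X Y = g.inner x X (φ x Y)

end Contact

/-! ### The metric symplectization -/

section Symplectization

variable {E : Type*} [NormedAddCommGroup E] [NormedSpace ℝ E]
  {M : Type*} [TopologicalSpace M] [ChartedSpace E M]

/-- The model with corners of `M × ℝ`. -/
abbrev symplModel (E : Type*) [NormedAddCommGroup E] [NormedSpace ℝ E] :
    ModelWithCorners ℝ (E × ℝ) (ModelProd E ℝ) :=
  𝓘(ℝ, E).prod 𝓘(ℝ, ℝ)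

/-- The tangent vector `v + s ∂_t` of `M × ℝ` at `p = (x, t)`, where `v` is tangent to `M` at
`x`. -/
def prodVec (p : M × ℝ) (v : TangentSpace 𝓘(ℝ, E) p.1) (s : ℝ) : TangentSpace (symplModel E) p :=
  ((v, s) : E × ℝ)

/-- The coordinate vector field `∂_t` on `M × ℝ`. -/
def partialT (p : M × ℝ) : TangentSpace (symplModel E) p :=
  prodVec p 0 1

/-- The one-form `e^{2t} η` on `M × ℝ`. -/
def liouvilleForm (η : ∀ x : M, TangentSpace 𝓘(ℝ, E) x →L[ℝ] ℝ) (p : M × ℝ) :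
    TangentSpace (symplModel E) p →L[ℝ] ℝ :=
  Real.exp (2 * p.2) • (η p.1).comp (mfderiv (symplModel E) 𝓘(ℝ, E) Prod.fst p)

/-- The symplectic form `ω = d(e^{2t} η)` of the symplectization `M × ℝ`. -/
def symplecticForm (η : ∀ x : M, TangentSpace 𝓘(ℝ, E) x →L[ℝ] ℝ) (p : M × ℝ)
    (u v : TangentSpace (symplModel E) p) : ℝ :=
  extDerivOneForm (symplModel E) (liouvilleForm η) p u v

/-- `(M × ℝ, ω, ḡ, J)` is the metric symplectization of the contact metric manifold
`(M, η, g, φ)`: `J` is an almost complex structure and `ḡ` a Riemannian metric on `M × ℝ` with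
`ḡ(X, JY) = ω(X, Y)`, such that `∂_t` is of unit length and orthogonal to the slices `M × {t}`, and
`J` agrees with `φ` on the contact distribution `ker η` of each slice. -/
structure IsMetricSymplectization [IsManifold 𝓘(ℝ, E) ∞ M] {n : ℕ}
    (C : ContactMetricStructure n E M)
    (gbar : ContMDiffRiemannianMetric (symplModel E) ∞ (E × ℝ)
      (fun p : M × ℝ => TangentSpace (symplModel E) p))
    (J : ∀ p : M × ℝ, TangentSpace (symplModel E) p →L[ℝ] TangentSpace (symplModel E) p) :
    Prop where
  contMDiff_J : ContMDiff (symplModel E) ((symplModel E).prod 𝓘(ℝ, E × ℝ →L[ℝ] E × ℝ)) ∞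
    (fun p : M × ℝ => TotalSpace.mk' (E × ℝ →L[ℝ] E × ℝ)
      (E := fun p : M × ℝ => TangentSpace (symplModel E) p →L[ℝ] TangentSpace (symplModel E) p)
      p (J p))
  J_sq : ∀ (p : M × ℝ) (u : TangentSpace (symplModel E) p), J p (J p u) = -u
  compatible : ∀ (p : M × ℝ) (u v : TangentSpace (symplModel E) p),
    gbar.inner p u (J p v) = symplecticForm C.η p u v
  unit : ∀ p : M × ℝ, gbar.inner p (partialT p) (partialT p) = 1
  orthogonal : ∀ (p : M × ℝ) (v : TangentSpace 𝓘(ℝ, E) p.1),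
    gbar.inner p (partialT p) (prodVec p v 0) = 0
  agrees : ∀ (p : M × ℝ) (v : TangentSpace 𝓘(ℝ, E) p.1), C.η p.1 v = 0 →
    J p (prodVec p v 0) = prodVec p (C.φ p.1 v) 0

end Symplectization

/-! ### Existence of the metric symplectization

The facts below show that the definition above is never vacuous: the Riemannian metric
`dt² + e^{2t} g + e^{2t} (e^{2t} - 1) η ⊗ η` and the almost complex structure with
`J X = φ X` on `ker η`, `J ξ = e^{2t} ∂_t`, `J ∂_t = - e^{-2t} ξ` satisfy it. -/

section Aux

set_option linter.unusedSectionVars false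

variable {E : Type*} [NormedAddCommGroup E] [NormedSpace ℝ E]
  {M : Type*} [TopologicalSpace M] [ChartedSpace E M] [IsManifold 𝓘(ℝ, E) ∞ M]

theorem chartVec_self (p : M) :
    chartVec 𝓘(ℝ, E) p (extChartAt 𝓘(ℝ, E) p p) = ContinuousLinearMap.id ℝ E := by
  have : IsManifold 𝓘(ℝ, E) 1 M := IsManifold.of_le (n := ∞) (by simp)
  have := mfderivWithin_range_extChartAt_symm (I := 𝓘(ℝ, E)) (x := p)
  simp only [modelWithCornersSelf_coe, Set.range_id, mfderivWithin_univ] at this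
  exact this

theorem chartVec_eq_symmL (p : M) {y : E} (hy : y ∈ (extChartAt 𝓘(ℝ, E) p).target) :
    chartVec 𝓘(ℝ, E) p y =
      (trivializationAt E (TangentSpace 𝓘(ℝ, E)) p).symmL ℝ ((extChartAt 𝓘(ℝ, E) p).symm y) := by
  have : IsManifold 𝓘(ℝ, E) 1 M := IsManifold.of_le (n := ∞) (by simp)
  have h := (extChartAt 𝓘(ℝ, E) p).map_target hy
  rw [extChartAt_source] at h
  have := TangentBundle.symmL_trivializationAt (I := 𝓘(ℝ, E)) h
  rw [this, (extChartAt 𝓘(ℝ, E) p).right_inv hy]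
  simp only [modelWithCornersSelf_coe, Set.range_id, mfderivWithin_univ]
  rfl

theorem differentiableAt_chartOneForm (η : ∀ x : M, TangentSpace 𝓘(ℝ, E) x →L[ℝ] ℝ)
    (h : ContMDiff 𝓘(ℝ, E) (𝓘(ℝ, E).prod 𝓘(ℝ, E →L[ℝ] ℝ)) ∞
    (fun x : M => TotalSpace.mk' (E →L[ℝ] ℝ)
      (E := fun x : M => TangentSpace 𝓘(ℝ, E) x →L[ℝ] (Trivial M ℝ x)) x (η x))) (p : M) :
    DifferentiableAt ℝ (chartOneForm 𝓘(ℝ, E) η p) (extChartAt 𝓘(ℝ, E) p p) := by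
  have h1 := ((contMDiffAt_hom_bundle _).1 (h p)).2
  have h2 : ContMDiffAt 𝓘(ℝ, E) 𝓘(ℝ, E) ∞ (extChartAt 𝓘(ℝ, E) p).symm
      (extChartAt 𝓘(ℝ, E) p p) :=
    (contMDiffOn_extChartAt_symm p).contMDiffAt (extChartAt_target_mem_nhds p)
  have h3 := ContMDiffAt.comp_of_eq h1 h2 (by simp)
  have h4 : DifferentiableAt ℝ _ _ := (h3.contDiffAt).differentiableAt (by simp)
  refine h4.congr_of_eventuallyEq ?_
  filter_upwards [extChartAt_target_mem_nhds (I := 𝓘(ℝ, E)) p] with y hy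
  have hs := (extChartAt 𝓘(ℝ, E) p).map_target hy
  rw [extChartAt_source] at hs
  simp only [Function.comp_apply]
  rw [ContinuousLinearMap.inCoordinates_eq (by simpa using hs) (by simp)]
  ext v
  rw [chartOneForm, chartVec_eq_symmL p hy]
  rw [ContinuousLinearMap.comp_apply]
  exact congrArg (η _) (congrFun (Trivialization.symm_continuousLinearEquivAt_eq _ _) v).symm

theorem extChartAt_symm_prod (p : M × ℝ) :
    ((extChartAt (symplModel E) p).symm : E × ℝ → M × ℝ) =
      Prod.map (extChartAt 𝓘(ℝ, E) p.1).symm id := by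
  rw [extChartAt_prod]
  simp [PartialEquiv.prod]
  rfl

theorem extChartAt_prod_self (p : M × ℝ) :
    (extChartAt (symplModel E) p p) = (extChartAt 𝓘(ℝ, E) p.1 p.1, p.2) := by
  rfl

theorem chartVec_prod (p : M × ℝ) {z : E × ℝ} (hz : z.1 ∈ (extChartAt 𝓘(ℝ, E) p.1).target) :
    chartVec (symplModel E) p z =
     ((chartVec 𝓘(ℝ, E) p.1 z.1 : E →L[ℝ] E).prodMap (ContinuousLinearMap.id ℝ ℝ) : E × ℝ →L[ℝ] E × ℝ) := by
  have : IsManifold 𝓘(ℝ, E) 1 M := IsManifold.of_le (n := ∞) (by simp)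
  have h1 : MDifferentiableAt 𝓘(ℝ, E) 𝓘(ℝ, E) (extChartAt 𝓘(ℝ, E) p.1).symm z.1 :=
    ((contMDiffOn_extChartAt_symm (n := 1) p.1).contMDiffAt
      ((isOpen_extChartAt_target p.1).mem_nhds hz)).mdifferentiableAt (by simp)
  have h2 : MDifferentiableAt 𝓘(ℝ, ℝ) 𝓘(ℝ, ℝ) (id : ℝ → ℝ) z.2 := mdifferentiableAt_id
  have := mfderiv_prodMap (p := z) h1 h2
  unfold chartVec
  rw [extChartAt_symm_prod, modelWithCornersSelf_prod, ← chartedSpaceSelf_prod, this, mfderiv_id]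
  rfl

theorem liouvilleForm_apply (η : ∀ x : M, TangentSpace 𝓘(ℝ, E) x →L[ℝ] ℝ) (p : M × ℝ)
    (v : TangentSpace 𝓘(ℝ, E) p.1) (s : ℝ) :
    liouvilleForm η p (prodVec p v s) = Real.exp (2 * p.2) * η p.1 v := by
  unfold liouvilleForm
  rw [mfderiv_fst]
  rfl

theorem chartOneForm_liouville (η : ∀ x : M, TangentSpace 𝓘(ℝ, E) x →L[ℝ] ℝ) (p : M × ℝ)
    {z : E × ℝ} (hz : z.1 ∈ (extChartAt 𝓘(ℝ, E) p.1).target) :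
    chartOneForm (symplModel E) (liouvilleForm η) p z =
     Real.exp (2 * z.2) • (chartOneForm 𝓘(ℝ, E) η p.1 z.1).comp (ContinuousLinearMap.fst ℝ E ℝ) := by
  refine ContinuousLinearMap.ext fun v => ?_
  unfold chartOneForm
  rw [chartVec_prod p hz]
  exact liouvilleForm_apply η ((extChartAt (symplModel E) p).symm z) _ _

theorem symplecticForm_apply (η : ∀ x : M, TangentSpace 𝓘(ℝ, E) x →L[ℝ] ℝ)
    (h : ContMDiff 𝓘(ℝ, E) (𝓘(ℝ, E).prod 𝓘(ℝ, E →L[ℝ] ℝ)) ∞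
    (fun x : M => TotalSpace.mk' (E →L[ℝ] ℝ)
      (E := fun x : M => TangentSpace 𝓘(ℝ, E) x →L[ℝ] (Trivial M ℝ x)) x (η x))) (p : M × ℝ)
    (a b : TangentSpace 𝓘(ℝ, E) p.1) (r s : ℝ) :
    symplecticForm η p (prodVec p a r) (prodVec p b s) =
      Real.exp (2 * p.2) * (r * η p.1 b - s * η p.1 a + extDerivOneForm 𝓘(ℝ, E) η p.1 a b) := by
  have hd := (differentiableAt_chartOneForm η h p.1).hasFDerivAt
  set y₀ := extChartAt 𝓘(ℝ, E) p.1 p.1 with hy₀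
  set D := fderiv ℝ (chartOneForm 𝓘(ℝ, E) η p.1) y₀ with hD
  have hd' : HasFDerivAt (fun z : E × ℝ => chartOneForm 𝓘(ℝ, E) η p.1 z.1)
      (D.comp (ContinuousLinearMap.fst ℝ E ℝ)) (y₀, p.2) :=
    HasFDerivAt.comp (y₀, p.2) (f := Prod.fst) hd hasFDerivAt_fst
  have he : HasFDerivAt (fun z : E × ℝ => Real.exp (2 * z.2))
      (Real.exp (2 * p.2) • ((2:ℝ) • ContinuousLinearMap.snd ℝ E ℝ)) (y₀, p.2) :=
    ((hasFDerivAt_snd (𝕜 := ℝ) (p := (y₀, p.2))).const_mul 2).exp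
  have hc := he.smul (hd'.clm_comp (hasFDerivAt_const (ContinuousLinearMap.fst ℝ E ℝ) (y₀, p.2)))
  have hev : chartOneForm (symplModel E) (liouvilleForm η) p =ᶠ[𝓝 (y₀, p.2)] fun z =>
      Real.exp (2 * z.2) • (chartOneForm 𝓘(ℝ, E) η p.1 z.1).comp (ContinuousLinearMap.fst ℝ E ℝ) := by
    have : ∀ᶠ z : E × ℝ in 𝓝 (y₀, p.2), z.1 ∈ (extChartAt 𝓘(ℝ, E) p.1).target :=
      (continuous_fst.continuousAt (x := (y₀, p.2))).eventually (extChartAt_target_mem_nhds (I := 𝓘(ℝ, E)) p.1)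
    filter_upwards [this] with z hz using chartOneForm_liouville η p hz
  have hη : ∀ w : E, chartOneForm 𝓘(ℝ, E) η p.1 y₀ w = η p.1 w := by
    intro w
    unfold chartOneForm
    rw [hy₀, chartVec_self, extChartAt_to_inv]
    rfl
  have hf := hc.congr_of_eventuallyEq hev
  have hfd : ∀ u v : E × ℝ, fderiv ℝ (chartOneForm (symplModel E) (liouvilleForm η) p)
      (extChartAt (symplModel E) p p) u v =
      Real.exp (2 * p.2) * (D u.1 v.1 + 2 * u.2 * η p.1 v.1) := by
    intro u v
    rw [extChartAt_prod_self, ← hy₀, hf.fderiv]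
    simp [hη]
    ring
  unfold symplecticForm extDerivOneForm
  have h1 := hfd (prodVec p a r) (prodVec p b s)
  have h2 := hfd (prodVec p b s) (prodVec p a r)
  refine (congrArg₂ (fun c d : ℝ => 1 / 2 * (c - d)) h1 h2).trans ?_
  change 1 / 2 * (Real.exp (2 * p.2) * (D a b + 2 * r * η p.1 b)
    - Real.exp (2 * p.2) * (D b a + 2 * s * η p.1 a)) = Real.exp (2 * p.2) *
      (r * η p.1 b - s * η p.1 a + 1 / 2 * (D a b - D b a))
  ring

end Aux
section HomAux

set_option linter.unusedSectionVars false

variable {B F₁ F₂ : Type*} {n : WithTop ℕ∞}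
  {E₁ : B → Type*} [∀ x, AddCommGroup (E₁ x)] [∀ x, Module ℝ (E₁ x)]
  [NormedAddCommGroup F₁] [NormedSpace ℝ F₁] [FiniteDimensional ℝ F₁]
  [TopologicalSpace (TotalSpace F₁ E₁)] [∀ x, TopologicalSpace (E₁ x)]
  {E₂ : B → Type*} [∀ x, AddCommGroup (E₂ x)] [∀ x, Module ℝ (E₂ x)]
  [NormedAddCommGroup F₂] [NormedSpace ℝ F₂]
  [TopologicalSpace (TotalSpace F₂ E₂)] [∀ x, TopologicalSpace (E₂ x)]
  {EB : Type*} [NormedAddCommGroup EB] [NormedSpace ℝ EB] {HB : Type*} [TopologicalSpace HB]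
  {IB : ModelWithCorners ℝ EB HB} [TopologicalSpace B] [ChartedSpace HB B]
  [FiberBundle F₁ E₁] [VectorBundle ℝ F₁ E₁] [FiberBundle F₂ E₂] [VectorBundle ℝ F₂ E₂]
  [∀ x, IsTopologicalAddGroup (E₂ x)] [∀ x, ContinuousSMul ℝ (E₂ x)]

theorem contMDiffAt_hom_of_apply (φ : ∀ b, E₁ b →L[ℝ] E₂ b) (x₀ : B)
    (h : ∀ v : F₁, ContMDiffAt IB (IB.prod 𝓘(ℝ, F₂)) n (fun b => TotalSpace.mk' F₂ b
      (φ b ((trivializationAt F₁ E₁ x₀).symmL ℝ b v))) x₀) :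
    ContMDiffAt IB (IB.prod 𝓘(ℝ, F₁ →L[ℝ] F₂)) n (fun b => TotalSpace.mk' (F₁ →L[ℝ] F₂)
      (E := fun b => E₁ b →L[ℝ] E₂ b) b (φ b)) x₀ := by
  refine (contMDiffAt_hom_bundle _).2 ⟨contMDiffAt_id, ?_⟩
  let bs := Module.finBasis ℝ F₁
  have key : ContMDiffAt IB 𝓘(ℝ, F₁ →L[ℝ] F₂) n (fun b => ∑ i,
      ContinuousLinearMap.smulRightL ℝ F₁ F₂ (LinearMap.toContinuousLinearMap (bs.coord i))
        (trivializationAt F₂ E₂ x₀ (TotalSpace.mk' F₂ b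
          (φ b ((trivializationAt F₁ E₁ x₀).symmL ℝ b (bs i))))).2) x₀ := by
    refine ContMDiffAt.sum fun i _ => ?_
    exact (ContinuousLinearMap.contMDiff _).contMDiffAt.comp x₀ (contMDiffAt_totalSpace.1 (h (bs i))).2
  refine key.congr_of_eventuallyEq ?_
  filter_upwards [(trivializationAt F₁ E₁ x₀).open_baseSet.mem_nhds
      (FiberBundle.mem_baseSet_trivializationAt' x₀),
    (trivializationAt F₂ E₂ x₀).open_baseSet.mem_nhds
      (FiberBundle.mem_baseSet_trivializationAt' x₀)] with b h1 h2
  rw [ContinuousLinearMap.inCoordinates_eq h1 h2]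
  refine ContinuousLinearMap.coe_injective (bs.ext fun j => ?_)
  simp [Finsupp.single_apply]
  rw [Trivialization.symmL_apply _ h1]

end HomAux

section Exist

set_option linter.unusedSectionVars false

variable {E : Type*} [NormedAddCommGroup E] [NormedSpace ℝ E]
  {M : Type*} [TopologicalSpace M] [ChartedSpace E M]

/-- The component tangent to `M` of a tangent vector of `M × ℝ`. -/
def fstL (p : M × ℝ) : TangentSpace (symplModel E) p →L[ℝ] TangentSpace 𝓘(ℝ, E) p.1 :=
  ContinuousLinearMap.fst ℝ E ℝ

/-- The one-form `dt` on `M × ℝ`. -/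
def dt (p : M × ℝ) : TangentSpace (symplModel E) p →L[ℝ] ℝ :=
  ContinuousLinearMap.snd ℝ E ℝ

/-- The inclusion of the vectors tangent to the slices. -/
def inlL (p : M × ℝ) : TangentSpace 𝓘(ℝ, E) p.1 →L[ℝ] TangentSpace (symplModel E) p :=
  ContinuousLinearMap.inl ℝ E ℝ

variable [IsManifold 𝓘(ℝ, E) ∞ M] {n : ℕ}

/-- The form `dt² + e^{2t} g + e^{2t} (e^{2t} - 1) η ⊗ η`. -/
def gbarInner (C : ContactMetricStructure n E M) (p : M × ℝ) :
    TangentSpace (symplModel E) p →L[ℝ] TangentSpace (symplModel E) p →L[ℝ] ℝ :=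
  (dt p).smulRight (dt p)
    + Real.exp (2 * p.2) • (ContinuousLinearMap.precomp ℝ (fstL p)).comp
        ((C.g.inner p.1).comp (fstL p))
    + (Real.exp (2 * p.2) * (Real.exp (2 * p.2) - 1)) •
        ((C.η p.1).comp (fstL p)).smulRight ((C.η p.1).comp (fstL p))

/-- `J(v + s ∂_t) = φ v - s e^{-2t} ξ + e^{2t} η(v) ∂_t`. -/
def Jbar (C : ContactMetricStructure n E M) (p : M × ℝ) :
    TangentSpace (symplModel E) p →L[ℝ] TangentSpace (symplModel E) p :=
  (inlL p).comp ((C.φ p.1).comp (fstL p))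
    - (dt p).smulRight (Real.exp (-(2 * p.2)) • inlL p (C.ξ p.1))
    + Real.exp (2 * p.2) • ((C.η p.1).comp (fstL p)).smulRight (partialT p)

theorem gbarInner_apply (C : ContactMetricStructure n E M) (p : M × ℝ)
    (u v : TangentSpace (symplModel E) p) :
    gbarInner C p u v = dt p u * dt p v + Real.exp (2 * p.2) * C.g.inner p.1 (fstL p u) (fstL p v)
      + Real.exp (2 * p.2) * (Real.exp (2 * p.2) - 1) *
        (C.η p.1 (fstL p u) * C.η p.1 (fstL p v)) := rfl

theorem Jbar_prodVec (C : ContactMetricStructure n E M) (p : M × ℝ)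
    (v : TangentSpace 𝓘(ℝ, E) p.1) (s : ℝ) :
    Jbar C p (prodVec p v s) =
      prodVec p (C.φ p.1 v - (s * Real.exp (-(2 * p.2))) • C.ξ p.1)
        (Real.exp (2 * p.2) * C.η p.1 v) := by
  refine Prod.ext ?_ ?_
  · change C.φ p.1 v - s • (Real.exp (-(2 * p.2)) • C.ξ p.1)
      + Real.exp (2 * p.2) • (C.η p.1 v • (0 : TangentSpace 𝓘(ℝ, E) p.1)) = _
    rw [smul_zero, smul_zero, add_zero, smul_smul]
    rfl
  · change (0:ℝ) - s * (Real.exp (-(2 * p.2)) * 0) + Real.exp (2 * p.2) * (C.η p.1 v * 1) = _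
    rw [mul_zero, mul_zero, sub_zero, zero_add, mul_one]
    rfl

theorem prodVec_surj (p : M × ℝ) (u : TangentSpace (symplModel E) p) :
    u = prodVec p (fstL p u) (dt p u) := rfl

theorem fstL_prodVec (p : M × ℝ) (v : TangentSpace 𝓘(ℝ, E) p.1) (s : ℝ) :
    fstL p (prodVec p v s) = v := rfl
theorem dt_prodVec (p : M × ℝ) (v : TangentSpace 𝓘(ℝ, E) p.1) (s : ℝ) :
    dt p (prodVec p v s) = s := rfl

theorem η_φ (C : ContactMetricStructure n E M) (x : M) (X : TangentSpace 𝓘(ℝ, E) x) :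
    C.η x (C.φ x X) = 0 := by
  rw [← C.g_ξ, C.g.symm, ← C.dη_eq, C.dη_ξ]

theorem extDeriv_swap (η : ∀ x : M, TangentSpace 𝓘(ℝ, E) x →L[ℝ] ℝ) (x : M)
    (X Y : TangentSpace 𝓘(ℝ, E) x) :
    extDerivOneForm 𝓘(ℝ, E) η x X Y = - extDerivOneForm 𝓘(ℝ, E) η x Y X := by
  unfold extDerivOneForm; ring

theorem φ_ξ (C : ContactMetricStructure n E M) (x : M) : C.φ x (C.ξ x) = 0 := by
  by_contra h
  have := C.g.pos x _ h
  rw [← C.dη_eq, extDeriv_swap, C.dη_ξ] at this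
  simp at this

theorem η_sq_le (C : ContactMetricStructure n E M) (x : M) (v : TangentSpace 𝓘(ℝ, E) x) :
    C.η x v ^ 2 ≤ C.g.inner x v v := by
  have h : 0 ≤ C.g.inner x (v - C.η x v • C.ξ x) (v - C.η x v • C.ξ x) := by
    by_cases h0 : v - C.η x v • C.ξ x = 0
    · rw [h0]; simp
    · exact (C.g.pos x _ h0).le
  simp only [map_sub, map_smul, sub_apply, smul_apply,
    smul_eq_mul, C.g_ξ, C.η_ξ] at h
  rw [C.g.symm x (C.ξ x), C.g_ξ] at h
  nlinarith

theorem compat_bar (C : ContactMetricStructure n E M) (p : M × ℝ)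
    (u v : TangentSpace (symplModel E) p) :
    gbarInner C p u (Jbar C p v) = symplecticForm C.η p u v := by
  rw [prodVec_surj p u, prodVec_surj p v]
  rw [symplecticForm_apply C.η C.contMDiff_η, Jbar_prodVec, gbarInner_apply]
  simp only [fstL_prodVec, dt_prodVec, map_sub, map_smul, C.g_ξ, C.η_ξ, η_φ, C.dη_eq,
    smul_eq_mul]
  rw [Real.exp_neg]
  field_simp
  ring

theorem J_sq_bar (C : ContactMetricStructure n E M) (p : M × ℝ)
    (u : TangentSpace (symplModel E) p) : Jbar C p (Jbar C p u) = -u := by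
  rw [prodVec_surj p u, Jbar_prodVec, Jbar_prodVec]
  simp only [map_sub, map_smul, C.φ_sq, φ_ξ, η_φ, C.η_ξ, smul_zero, sub_zero, smul_eq_mul]
  have h : Real.exp (2 * p.2) * Real.exp (-(2 * p.2)) = 1 := by rw [← Real.exp_add]; simp
  refine Prod.ext ?_ ?_
  · change -fstL p u + C.η p.1 (fstL p u) • C.ξ p.1 - (Real.exp (2 * p.2) * C.η p.1 (fstL p u) *
      Real.exp (-(2 * p.2))) • C.ξ p.1 = - fstL p u
    rw [mul_right_comm, h, one_mul]; abel
  · change Real.exp (2 * p.2) * (0 - dt p u * Real.exp (-(2 * p.2)) * 1) = - dt p u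
    linear_combination (- dt p u) * h

theorem gbar_pos (C : ContactMetricStructure n E M) (p : M × ℝ)
    (u : TangentSpace (symplModel E) p) (hu : u ≠ 0) : 0 < gbarInner C p u u := by
  rw [gbarInner_apply]
  have h1 := η_sq_le C p.1 (fstL p u)
  have he := Real.exp_pos (2 * p.2)
  by_cases h0 : fstL p u = 0
  · have : dt p u ≠ 0 := fun h => hu (Prod.ext h0 h)
    rw [h0]
    simp only [map_zero, mul_zero, add_zero]
    exact mul_self_pos.2 this
  · have h2 := C.g.pos p.1 _ h0
    by_cases h3 : C.η p.1 (fstL p u) = 0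
    · rw [h3]
      have : 0 < Real.exp (2 * p.2) * C.g.inner p.1 (fstL p u) (fstL p u) := by positivity
      nlinarith [mul_self_nonneg (dt p u)]
    · have h4 : 0 < Real.exp (2 * p.2) * Real.exp (2 * p.2) * C.η p.1 (fstL p u) ^ 2 := by positivity
      nlinarith [mul_self_nonneg (dt p u)]

theorem gbar_bdd (C : ContactMetricStructure n E M) (p : M × ℝ) :
    Bornology.IsVonNBounded ℝ {v : TangentSpace (symplModel E) p | gbarInner C p v v < 1} := by
  have hb := C.g.isVonNBounded p.1
  have he := Real.exp_pos (2 * p.2)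
  set e := Real.exp (2 * p.2) with hedef
  have hc : 0 < 1 / e + 1 / e ^ 2 := by positivity
  obtain ⟨c, hc0, hc⟩ : ∃ c : ℝ, 0 < c ∧ 1 / e + 1 / e ^ 2 = c ^ 2 :=
    ⟨√(1 / e + 1 / e ^ 2), Real.sqrt_pos.2 hc, (Real.sq_sqrt hc.le).symm⟩
  have hb2 : Bornology.IsVonNBounded ℝ
      ((fun v => c • v) '' {v : TangentSpace 𝓘(ℝ, E) p.1 | C.g.inner p.1 v v < 1}) :=
    Bornology.IsVonNBounded.image (E := E) (F := E) hb (c • ContinuousLinearMap.id ℝ E)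
  have hb3 : Bornology.IsBounded (α := E) ((fun v => c • v) '' {v : TangentSpace 𝓘(ℝ, E) p.1 | C.g.inner p.1 v v < 1}) :=
    (NormedSpace.isVonNBounded_iff ℝ).1 hb2
  have hb4 := hb3.prod (Metric.isBounded_ball (x := (0:ℝ)) (r := 1))
  refine ((NormedSpace.isVonNBounded_iff ℝ (E := E × ℝ)).2 hb4).subset ?_
  intro (v : TangentSpace (symplModel E) p) hv
  have h1 := η_sq_le C p.1 (fstL p v)
  change gbarInner C p v v < 1 at hv
  rw [gbarInner_apply, ← hedef] at hv
  have hG : 0 ≤ C.g.inner p.1 (fstL p v) (fstL p v) := (sq_nonneg _).trans h1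
  set G := C.g.inner p.1 (fstL p v) (fstL p v)
  set b := C.η p.1 (fstL p v)
  set s := dt p v
  have k1 : s * s + e * (G - b ^ 2) + e ^ 2 * b ^ 2 < 1 := by nlinarith
  have k2 : 0 ≤ e * (G - b ^ 2) := mul_nonneg he.le (by linarith)
  have k3 : 0 ≤ e ^ 2 * b ^ 2 := by positivity
  refine ⟨?_, ?_⟩
  · have : G < c ^ 2 := by
      rw [← hc]
      have a1 : G - b ^ 2 ≤ 1 / e := by
        rw [le_div_iff₀ he]; nlinarith
      have a2 : b ^ 2 ≤ 1 / e ^ 2 := by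
        rw [le_div_iff₀ (by positivity)]; nlinarith
      rcases eq_or_lt_of_le a1 with h | h
      · rw [eq_div_iff he.ne'] at h
        nlinarith
      · linarith
    refine ⟨c⁻¹ • fstL p v, ?_, ?_⟩
    · change C.g.inner p.1 (c⁻¹ • fstL p v) (c⁻¹ • fstL p v) < 1
      simp only [map_smul, smul_apply, smul_eq_mul]
      change c⁻¹ * (c⁻¹ * G) < 1
      rw [← mul_assoc, ← mul_inv, ← sq, inv_mul_lt_iff₀ (by positivity)]
      linarith
    · exact smul_inv_smul₀ hc0.ne' (fstL p v)
  · rw [mem_ball_zero_iff, Real.norm_eq_abs]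
    change |s| < 1
    rw [← sq_lt_one_iff_abs_lt_one]
    nlinarith

theorem contMDiffAt_frame {B F : Type*} {V : B → Type*} [∀ x, AddCommGroup (V x)]
    [∀ x, Module ℝ (V x)] [NormedAddCommGroup F] [NormedSpace ℝ F]
    [TopologicalSpace (TotalSpace F V)] [∀ x, TopologicalSpace (V x)]
    {EB : Type*} [NormedAddCommGroup EB] [NormedSpace ℝ EB] {HB : Type*} [TopologicalSpace HB]
    {IB : ModelWithCorners ℝ EB HB} [TopologicalSpace B] [ChartedSpace HB B]
    [FiberBundle F V] [VectorBundle ℝ F V] (x₀ : B) (v : F) :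
    ContMDiffAt IB (IB.prod 𝓘(ℝ, F)) ∞
      (fun b => TotalSpace.mk' F b ((trivializationAt F V x₀).symmL ℝ b v)) x₀ := by
  refine contMDiffAt_totalSpace.2 ⟨contMDiffAt_id, ?_⟩
  refine (contMDiffAt_const (c := v)).congr_of_eventuallyEq ?_
  filter_upwards [(trivializationAt F V x₀).open_baseSet.mem_nhds
      (FiberBundle.mem_baseSet_trivializationAt' x₀)] with b h1
  rw [Trivialization.symmL_apply _ h1]
  simp [Trivialization.apply_mk_symm _ h1]

theorem contMDiffAt_fstL {σ : ∀ p : M × ℝ, TangentSpace (symplModel E) p} {p₀ : M × ℝ}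
    (h : ContMDiffAt (symplModel E) (symplModel E).tangent ∞
      (fun p => (⟨p, σ p⟩ : TangentBundle (symplModel E) (M × ℝ))) p₀) :
    ContMDiffAt (symplModel E) 𝓘(ℝ, E).tangent ∞
      (fun p => (⟨p.1, fstL p (σ p)⟩ : TangentBundle 𝓘(ℝ, E) M)) p₀ := by
  have : IsManifold 𝓘(ℝ, E) 1 M := IsManifold.of_le (n := ∞) (by simp)
  exact contMDiffAt_fst.comp p₀ (((contMDiff_equivTangentBundleProd (n := ∞) (I := 𝓘(ℝ, E))
    (I' := 𝓘(ℝ, ℝ)) (M := M) (M' := ℝ)) _).comp p₀ h)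

theorem contMDiffAt_dt {σ : ∀ p : M × ℝ, TangentSpace (symplModel E) p} {p₀ : M × ℝ}
    (h : ContMDiffAt (symplModel E) (symplModel E).tangent ∞
      (fun p => (⟨p, σ p⟩ : TangentBundle (symplModel E) (M × ℝ))) p₀) :
    ContMDiffAt (symplModel E) 𝓘(ℝ, ℝ) ∞ (fun p => dt p (σ p)) p₀ := by
  have : IsManifold 𝓘(ℝ, E) 1 M := IsManifold.of_le (n := ∞) (by simp)
  have h2 := contMDiffAt_snd.comp p₀ (((contMDiff_equivTangentBundleProd (n := ∞) (I := 𝓘(ℝ, E))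
    (I' := 𝓘(ℝ, ℝ)) (M := M) (M' := ℝ)) _).comp p₀ h)
  exact (contMDiff_snd_tangentBundle_modelSpace ℝ 𝓘(ℝ, ℝ)).contMDiffAt.comp p₀ h2

theorem contMDiffAt_prodVec {w : ∀ p : M × ℝ, TangentSpace 𝓘(ℝ, E) p.1} {p₀ : M × ℝ}
    (h : ContMDiffAt (symplModel E) 𝓘(ℝ, E).tangent ∞
      (fun p => (⟨p.1, w p⟩ : TangentBundle 𝓘(ℝ, E) M)) p₀) (c : ℝ) :
    ContMDiffAt (symplModel E) (symplModel E).tangent ∞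
      (fun p => (⟨p, prodVec p (w p) c⟩ : TangentBundle (symplModel E) (M × ℝ))) p₀ := by
  have : IsManifold 𝓘(ℝ, E) 1 M := IsManifold.of_le (n := ∞) (by simp)
  have h2 : ContMDiffAt (symplModel E) 𝓘(ℝ, ℝ).tangent ∞
      (fun p : M × ℝ => (⟨p.2, c⟩ : TangentBundle 𝓘(ℝ, ℝ) ℝ)) p₀ := by
    refine contMDiffAt_totalSpace.2 ⟨contMDiffAt_snd, ?_⟩
    simp only [trivializationAt_model_space_apply]
    exact contMDiffAt_const
  exact ((contMDiff_equivTangentBundleProd_symm (n := ∞) (I := 𝓘(ℝ, E))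
    (I' := 𝓘(ℝ, ℝ)) (M := M) (M' := ℝ)) _).comp p₀ (h.prodMk h2)

theorem contMDiffAt_exp (c : ℝ) (p₀ : M × ℝ) :
    ContMDiffAt (symplModel E) 𝓘(ℝ, ℝ) ∞ (fun p : M × ℝ => Real.exp (c * p.2)) p₀ :=
  (((Real.contDiff_exp.comp (contDiff_const.mul contDiff_id)).contMDiff :
    ContMDiff 𝓘(ℝ, ℝ) 𝓘(ℝ, ℝ) ∞ (fun t : ℝ => Real.exp (c * t))) _).comp p₀ contMDiffAt_snd

theorem contMDiffAt_η (C : ContactMetricStructure n E M)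
    {w : ∀ p : M × ℝ, TangentSpace 𝓘(ℝ, E) p.1} {p₀ : M × ℝ}
    (h : ContMDiffAt (symplModel E) 𝓘(ℝ, E).tangent ∞
      (fun p => (⟨p.1, w p⟩ : TangentBundle 𝓘(ℝ, E) M)) p₀) :
    ContMDiffAt (symplModel E) 𝓘(ℝ, ℝ) ∞ (fun p => C.η p.1 (w p)) p₀ := by
  have h1 := ContMDiffAt.clm_bundle_apply (F₂ := ℝ) (E₂ := Trivial M ℝ) (b := Prod.fst)
    (ϕ := fun p : M × ℝ => C.η p.1) (v := w)
    ((C.contMDiff_η p₀.1).comp p₀ contMDiffAt_fst) h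
  exact (contMDiffAt_totalSpace.1 h1).2

theorem contMDiffAt_g (C : ContactMetricStructure n E M)
    {w w' : ∀ p : M × ℝ, TangentSpace 𝓘(ℝ, E) p.1} {p₀ : M × ℝ}
    (h : ContMDiffAt (symplModel E) 𝓘(ℝ, E).tangent ∞
      (fun p => (⟨p.1, w p⟩ : TangentBundle 𝓘(ℝ, E) M)) p₀)
    (h' : ContMDiffAt (symplModel E) 𝓘(ℝ, E).tangent ∞
      (fun p => (⟨p.1, w' p⟩ : TangentBundle 𝓘(ℝ, E) M)) p₀) :
    ContMDiffAt (symplModel E) 𝓘(ℝ, ℝ) ∞ (fun p => C.g.inner p.1 (w p) (w' p)) p₀ := by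
  have h1 := ContMDiffAt.clm_bundle_apply₂ (F₃ := ℝ) (E₃ := Trivial M ℝ) (b := Prod.fst)
    (ψ := fun p : M × ℝ => C.g.inner p.1) (v := w) (w := w')
    ((C.g.contMDiff p₀.1).comp p₀ contMDiffAt_fst) h h'
  exact (contMDiffAt_totalSpace.1 h1).2

theorem contMDiff_Jbar [FiniteDimensional ℝ E] (C : ContactMetricStructure n E M) :
    ContMDiff (symplModel E) ((symplModel E).prod 𝓘(ℝ, E × ℝ →L[ℝ] E × ℝ)) ∞
    (fun p : M × ℝ => TotalSpace.mk' (E × ℝ →L[ℝ] E × ℝ)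
      (E := fun p : M × ℝ => TangentSpace (symplModel E) p →L[ℝ] TangentSpace (symplModel E) p)
      p (Jbar C p)) := by
  intro p₀
  refine contMDiffAt_hom_of_apply _ p₀ fun v => ?_
  have hσ := contMDiffAt_frame (IB := symplModel E) (V := fun p : M × ℝ => TangentSpace (symplModel E) p) p₀ v
  have hf := contMDiffAt_fstL hσ
  have hd := contMDiffAt_dt hσ
  have h1 := contMDiffAt_prodVec
    (((C.contMDiff_φ p₀.1).comp p₀ contMDiffAt_fst).clm_bundle_apply hf) 0
  have h2 := contMDiffAt_prodVec ((C.contMDiff_ξ p₀.1).comp p₀ contMDiffAt_fst) 0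
  have h3 : ContMDiffAt (symplModel E) (symplModel E).tangent ∞
      (fun p => (⟨p, partialT p⟩ : TangentBundle (symplModel E) (M × ℝ))) p₀ :=
    contMDiffAt_prodVec (((contMDiff_zeroSection ℝ (TangentSpace 𝓘(ℝ, E) : M → Type _)) p₀.1).comp
      p₀ contMDiffAt_fst) 1
  have h4 := (h1.sub_section (hd.smul_section ((contMDiffAt_exp (-2) p₀).smul_section h2))).add_section
    ((contMDiffAt_exp 2 p₀).smul_section ((contMDiffAt_η C hf).smul_section h3))
  refine h4.congr_of_eventuallyEq (Eventually.of_forall fun p => ?_)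
  have : -2 * p.2 = -(2 * p.2) := by ring
  simp only [Pi.add_apply, Pi.sub_apply, Pi.smul_apply', this]
  rfl

theorem contMDiff_gbar [FiniteDimensional ℝ E] (C : ContactMetricStructure n E M) :
    ContMDiff (symplModel E) ((symplModel E).prod 𝓘(ℝ, E × ℝ →L[ℝ] E × ℝ →L[ℝ] ℝ)) ∞
    (fun p : M × ℝ => TotalSpace.mk' (E × ℝ →L[ℝ] E × ℝ →L[ℝ] ℝ)
      (E := fun p : M × ℝ => TangentSpace (symplModel E) p →L[ℝ] TangentSpace (symplModel E) p →L[ℝ] ℝ)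
      p (gbarInner C p)) := by
  intro p₀
  refine contMDiffAt_hom_of_apply (E₂ := fun p : M × ℝ => TangentSpace (symplModel E) p →L[ℝ] Trivial (M × ℝ) ℝ p) _ p₀ fun v => ?_
  refine contMDiffAt_hom_of_apply (E₂ := Trivial (M × ℝ) ℝ) _ p₀ fun w => ?_
  have hσ := contMDiffAt_frame (IB := symplModel E) (V := fun p : M × ℝ => TangentSpace (symplModel E) p) p₀ v
  have hτ := contMDiffAt_frame (IB := symplModel E) (V := fun p : M × ℝ => TangentSpace (symplModel E) p) p₀ w
  refine contMDiffAt_totalSpace.2 ⟨contMDiffAt_id, ?_⟩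
  have he := contMDiffAt_exp (E := E) 2 p₀
  exact (((contMDiffAt_dt hσ).mul (contMDiffAt_dt hτ)).add
    (he.mul (contMDiffAt_g C (contMDiffAt_fstL hσ) (contMDiffAt_fstL hτ)))).add
    ((he.mul (he.sub contMDiffAt_const)).mul
      ((contMDiffAt_η C (contMDiffAt_fstL hσ)).mul (contMDiffAt_η C (contMDiffAt_fstL hτ))))

/-- The Riemannian metric `dt² + e^{2t} g + e^{2t} (e^{2t} - 1) η ⊗ η`. -/
def gbar [FiniteDimensional ℝ E] (C : ContactMetricStructure n E M) :
    ContMDiffRiemannianMetric (symplModel E) ∞ (E × ℝ)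
      (fun p : M × ℝ => TangentSpace (symplModel E) p) where
  inner := gbarInner C
  symm p u v := by
    rw [gbarInner_apply, gbarInner_apply, C.g.symm]; ring
  pos := gbar_pos C
  isVonNBounded := gbar_bdd C
  contMDiff := contMDiff_gbar C

theorem isMetricSymplectization_gbar [FiniteDimensional ℝ E] (C : ContactMetricStructure n E M) :
    IsMetricSymplectization C (gbar C) (Jbar C) where
  contMDiff_J := contMDiff_Jbar C
  J_sq := J_sq_bar C
  compatible := compat_bar C
  unit p := by
    change gbarInner C p _ _ = 1
    rw [gbarInner_apply, partialT, fstL_prodVec, dt_prodVec]; simp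
  orthogonal p v := by
    change gbarInner C p _ _ = 0
    rw [gbarInner_apply, partialT, fstL_prodVec, dt_prodVec, fstL_prodVec, dt_prodVec]; simp
  agrees p v hv := by
    rw [Jbar_prodVec, hv]; simp

end Exist

end ContactMetric

end

namespace ContactMetric

/-! ### Local geometry along a vector field with constant dual -/

section Local

set_option synthInstance.maxHeartbeats 200000

variable {F F' : Type*} [NormedAddCommGroup F] [NormedSpace ℝ F]
  [NormedAddCommGroup F'] [NormedSpace ℝ F']

/-! The metric `ḡ = dt² + e^{2t} g + e^{2t}(e^{2t} - 1) η ⊗ η` has the form `dt² + h_t`, so the dual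
of `T = ∂_t` is `dt`, which has constant coefficients in a product chart. For such a field the
Christoffel formula collapses: `∇_T T = 0`, and `A = ∇T` is given by `ḡ(A u, v) = ½ (∂_T ḡ)(u, v)`.
Since `h_t` scales like `e^{2t}` on `ker η` and like `e^{4t}` on `ξ`, the operator `A` is `1` on
`ker η`, `2` on `ξ` and `0` on `T`. In particular it does not depend on `t`, so the Riccati equation
for `A` has no derivative term and reads `R(u, T) T = -A² u`. Taking the trace, `Ric(T, T) = -(2n ·
1² + 2²) = -(2n + 4)`. This is negative, which also refutes non-negative Ricci curvature.

The proof rests on three lemmas. `riemannCurvature_of_dual_const` is the Riccati computation for a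
metric on a vector space. `IsMetricSymplectization.inner_eq` derives the explicit formula for `ḡ`
from the defining conditions. `fderiv_chartTensor_partialT` identifies `A` with `chartShape`. -/

theorem contDiffAt_clm_of_apply [FiniteDimensional ℝ F] {D : Type*} [NormedAddCommGroup D] [NormedSpace ℝ D]
    {n : WithTop ℕ∞} {f : D → F →L[ℝ] F'} {x : D}
    (h : ∀ v, ContDiffAt ℝ n (fun y => f y v) x) : ContDiffAt ℝ n f x := by
  let b := Module.finBasis ℝ F
  have key : ContDiffAt ℝ n (fun y => ∑ i, ContinuousLinearMap.smulRightL ℝ F F'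
      (LinearMap.toContinuousLinearMap (b.coord i)) (f y (b i))) x :=
    ContDiffAt.sum fun i _ => (ContinuousLinearMap.contDiff _).contDiffAt.comp x (h (b i))
  refine key.congr_of_eventuallyEq (Eventually.of_forall fun y => ?_)
  refine ContinuousLinearMap.coe_injective (b.ext fun j => ?_)
  simp [Finsupp.single_apply]

/-- Definiteness makes `B` injective into the dual, which has the same dimension. This is needed
because `christoffel` raises indices with `ContinuousLinearMap.inverse`, which is meaningful only
for invertible maps. -/
theorem isInvertible_of_pos [FiniteDimensional ℝ F] {B : F →L[ℝ] F →L[ℝ] ℝ} (hB : ∀ v, v ≠ 0 → 0 < B v v) :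
    B.IsInvertible := by
  have hinj : Function.Injective B := by
    refine (injective_iff_map_eq_zero B).2 fun v hv => ?_
    by_contra h0
    have := hB v h0
    simp [hv] at this
  have hfr : Module.finrank ℝ F = Module.finrank ℝ (F →L[ℝ] ℝ) := by
    rw [← (LinearMap.toContinuousLinearMap (𝕜 := ℝ) (E := F) (F' := ℝ)).finrank_eq]
    exact Subspace.dual_finrank_eq.symm
  let e := LinearEquiv.ofInjectiveOfFinrankEq (B : F →ₗ[ℝ] F →L[ℝ] ℝ) hinj hfr
  exact ⟨e.toContinuousLinearEquiv, by ext; rfl⟩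

theorem sum_coord_eq_trace [FiniteDimensional ℝ F] (L : F →ₗ[ℝ] F) :
    ∑ i, (Module.finBasis ℝ F).coord i (L (Module.finBasis ℝ F i)) = LinearMap.trace ℝ F L := by
  rw [LinearMap.trace_eq_matrix_trace ℝ (Module.finBasis ℝ F)]
  simp [Matrix.trace, LinearMap.toMatrix_apply]

/-- No differentiability is assumed: where it fails, `fderiv` takes the default value `0`. Thus the
Christoffel symbols need not be shown differentiable before their derivative along `T` is discarded.
-/
theorem fderiv_apply_eq_zero_of_const_line {f : F → F'} {z T : F} {c : F'}
    (h : ∀ᶠ s : ℝ in 𝓝 0, f (z + s • T) = c) : fderiv ℝ f z T = 0 := by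
  by_cases hf : DifferentiableAt ℝ f z
  · rw [← hf.lineDeriv_eq_fderiv]
    have : (fun s : ℝ => f (z + s • T)) =ᶠ[𝓝 0] fun _ => c := h
    rw [lineDeriv, this.deriv_eq, deriv_const]
  · rw [fderiv_zero_of_not_differentiableAt hf]; rfl

/-! ### Christoffel symbols and curvature along a field with constant dual -/

variable {G : F → F →L[ℝ] F →L[ℝ] ℝ} {T z : F} {τ : F →L[ℝ] ℝ}

theorem fderiv_apply_of_dual_const (hd : DifferentiableAt ℝ G z) (hτ : ∀ᶠ y in 𝓝 z, G y T = τ)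
    (u : F) : fderiv ℝ G z u T = 0 := by
  have h1 : HasFDerivAt (fun y => G y T) ((fderiv ℝ G z).flip T) z := by
    simpa using hd.hasFDerivAt.clm_apply (hasFDerivAt_const T z)
  have h2 : HasFDerivAt (fun y => G y T) (0 : F →L[ℝ] F →L[ℝ] ℝ) z :=
    (hasFDerivAt_const τ z).congr_of_eventuallyEq hτ
  exact congrArg (fun L => L u) (h1.unique h2)

theorem fderiv_symm (hd : DifferentiableAt ℝ G z)
    (hs : ∀ᶠ y in 𝓝 z, ∀ u v, G y u v = G y v u) (w u v : F) :
    fderiv ℝ G z w u v = fderiv ℝ G z w v u := by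
  have h : ∀ u v, HasFDerivAt (fun y => G y u v) (((fderiv ℝ G z).flip u).flip v) z := fun u v => by
    simpa using (hd.hasFDerivAt.clm_apply (hasFDerivAt_const u z)).clm_apply (hasFDerivAt_const v z)
  exact congrArg (fun L => L w) ((h u v).unique
    ((h v u).congr_of_eventuallyEq (hs.mono fun y hy => hy u v)))

/-- Two of the three terms in the Christoffel formula differentiate a component `G(T, ·)`, which is
constant; only the derivative in the direction `T` survives. Symmetry of `G` is used to bring `T`
into the first slot. -/
theorem christoffelLower_of_dual_const (hd : DifferentiableAt ℝ G z)
    (hτ : ∀ᶠ y in 𝓝 z, G y T = τ) (hs : ∀ᶠ y in 𝓝 z, ∀ u v, G y u v = G y v u) (u : F) :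
    christoffelLower G z u T = (1 / 2 : ℝ) • fderiv ℝ G z T u ∧
      christoffelLower G z T u = (1 / 2 : ℝ) • fderiv ℝ G z T u := by
  have h0 := fderiv_apply_of_dual_const hd hτ
  constructor <;> ext w
  · simp [christoffelLower, h0, fderiv_symm hd hs w u T]
  · simp [christoffelLower, h0]

/-- If the dual of the constant field `T` is constant, then `∇_T T = 0`, and
`R(u, T) T = - A (A u)` where `A = ∇T`, provided that `A` is constant along `T`. -/
theorem riemannCurvature_of_dual_const (hd : ∀ᶠ y in 𝓝 z, DifferentiableAt ℝ G y)
    (hτ : ∀ᶠ y in 𝓝 z, G y T = τ) (hs : ∀ᶠ y in 𝓝 z, ∀ u v, G y u v = G y v u)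
    (hi : ∀ᶠ y in 𝓝 z, (G y).IsInvertible) (A : F → F → F)
    (hA : ∀ᶠ y in 𝓝 z, ∀ u, G y (A y u) = (1 / 2 : ℝ) • fderiv ℝ G y T u)
    (hc : ∀ u, ∀ᶠ s : ℝ in 𝓝 0, A (z + s • T) u = A z u) (u : F) :
    riemannCurvature G z u T T = - A z (A z u) := by
  -- The identification with `A` must hold near `z` and not only at `z`, since the curvature
  -- differentiates the Christoffel symbols.
  have hΓ : ∀ᶠ y in 𝓝 z, ∀ u, christoffel G y u T = A y u ∧ christoffel G y T u = A y u := by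
    filter_upwards [hd, hτ.eventually_nhds, hs.eventually_nhds, hi, hA] with y h1 h2 h3 h4 h5 u
    obtain ⟨e1, e2⟩ := christoffelLower_of_dual_const h1 h2 h3 u
    exact ⟨(h4.inverse_apply_eq).2 (e1.trans (h5 u).symm),
      (h4.inverse_apply_eq).2 (e2.trans (h5 u).symm)⟩
  -- `G(A T, ·) = ½ ∂_T G(T, ·) = 0`, and `G` is invertible.
  have hTT : ∀ᶠ y in 𝓝 z, christoffel G y T T = 0 := by
    filter_upwards [hd, hτ.eventually_nhds, hi, hA, hΓ] with y h1 h2 h4 h5 h6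
    have e := h5 T
    rw [fderiv_apply_of_dual_const h1 h2, smul_zero] at e
    obtain ⟨E, hE⟩ := h4
    rw [(h6 T).1, ← E.map_eq_zero_iff]
    rw [← e, ← hE]
    rfl
  have hz := hΓ.self_of_nhds
  have h1 : fderiv ℝ (fun y => christoffel G y T T) z u = 0 := by
    have : (fun y => christoffel G y T T) =ᶠ[𝓝 z] fun _ => 0 := hTT
    rw [this.fderiv_eq]; simp
  have h2 : fderiv ℝ (fun y => christoffel G y u T) z T = 0 := by
    have : (fun y => christoffel G y u T) =ᶠ[𝓝 z] fun y => A y u := hΓ.mono fun y hy => (hy u).1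
    rw [this.fderiv_eq]
    exact fderiv_apply_eq_zero_of_const_line (hc u)
  have h3 : christoffel G z u 0 = 0 := by
    simp [christoffel, christoffelLower]
  rw [riemannCurvature, h1, h2, hTT.self_of_nhds, h3, (hz u).1, (hz _).2]
  simp

end Local

end ContactMetric

namespace ContactMetric

/-! ### Metrics in charts -/

section ChartMetric

variable {E : Type*} [NormedAddCommGroup E] [NormedSpace ℝ E]
  {H : Type*} [TopologicalSpace H] {I : ModelWithCorners ℝ E H}
  {M : Type*} [TopologicalSpace M] [ChartedSpace H M] [IsManifold I ∞ M]

theorem isInvertible_chartVec [I.Boundaryless] (p : M) {y : E} (hy : y ∈ (extChartAt I p).target) :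
    (chartVec I p y).IsInvertible := by
  have : IsManifold I 1 M := IsManifold.of_le (n := ∞) (by simp)
  have h := isInvertible_mfderivWithin_extChartAt_symm hy
  rwa [I.range_eq_univ, mfderivWithin_univ] at h

/-- The coordinate frame is the frame of the tangent bundle trivialization, which is known to be
smooth. A general boundaryless model is allowed so that the result applies to `symplModel`. -/
theorem chartVec_eq_symmL_trivializationAt [I.Boundaryless] (p : M) {y : E} (hy : y ∈ (extChartAt I p).target) :
    chartVec I p y = (trivializationAt E (TangentSpace I) p).symmL ℝ ((extChartAt I p).symm y) := by
  have : IsManifold I 1 M := IsManifold.of_le (n := ∞) (by simp)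
  have h := (extChartAt I p).map_target hy
  rw [extChartAt_source] at h
  rw [TangentBundle.symmL_trivializationAt (I := I) h, (extChartAt I p).right_inv hy]
  simp only [I.range_eq_univ, mfderivWithin_univ]
  rfl

theorem contDiffAt_chartTensor [I.Boundaryless] [FiniteDimensional ℝ E]
    (g : ContMDiffRiemannianMetric I ∞ E (fun x : M => TangentSpace I x)) (p : M) :
    ContDiffAt ℝ ∞ (chartTensor I g.inner p) (extChartAt I p p) := by
  refine contDiffAt_clm_of_apply fun v => contDiffAt_clm_of_apply fun w => ?_
  have h1 := ContMDiffAt.clm_bundle_apply₂ (F₃ := ℝ) (E₃ := Trivial M ℝ) (b := id)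
    (ψ := fun q : M => g.inner q) (g.contMDiff p)
    (contMDiffAt_frame (IB := I) (V := fun q : M => TangentSpace I q) p v)
    (contMDiffAt_frame (IB := I) (V := fun q : M => TangentSpace I q) p w)
  have h2 := (contMDiffAt_totalSpace.1 h1).2
  have h3 : ContMDiffAt 𝓘(ℝ, E) I ∞ (extChartAt I p).symm (extChartAt I p p) :=
    (contMDiffOn_extChartAt_symm p).contMDiffAt (extChartAt_target_mem_nhds p)
  have h4 := (ContMDiffAt.comp_of_eq h2 h3 (by simp)).contDiffAt
  refine h4.congr_of_eventuallyEq ?_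
  filter_upwards [extChartAt_target_mem_nhds (I := I) p] with y hy
  change g.inner _ (chartVec I p y v) (chartVec I p y w) = _
  rw [chartVec_eq_symmL_trivializationAt p hy]
  rfl

theorem chartTensor_pos [I.Boundaryless] (g : ContMDiffRiemannianMetric I ∞ E (fun x : M => TangentSpace I x))
    (p : M) {y : E} (hy : y ∈ (extChartAt I p).target) (v : E) (hv : v ≠ 0) :
    0 < chartTensor I g.inner p y v v := by
  refine g.pos _ (chartVec I p y v) fun h => hv ?_
  obtain ⟨e, he⟩ := isInvertible_chartVec p hy
  rw [← he] at h
  exact e.map_eq_zero_iff.1 h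

theorem chartTensor_symm (g : ContMDiffRiemannianMetric I ∞ E (fun x : M => TangentSpace I x))
    (p : M) (y u v : E) : chartTensor I g.inner p y u v = chartTensor I g.inner p y v u :=
  g.symm _ (chartVec I p y u) (chartVec I p y v)

end ChartMetric

/-! ### Uniqueness of the metric of the symplectization -/

section Unique

variable {E : Type*} [NormedAddCommGroup E] [NormedSpace ℝ E]
  {M : Type*} [TopologicalSpace M] [ChartedSpace E M]

theorem prodVec_add (p : M × ℝ) (a b : TangentSpace 𝓘(ℝ, E) p.1) (r s : ℝ) :
    prodVec p (a + b) (r + s) = prodVec p a r + prodVec p b s := rfl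

theorem prodVec_smul (p : M × ℝ) (c : ℝ) (a : TangentSpace 𝓘(ℝ, E) p.1) (r : ℝ) :
    prodVec p (c • a) (c * r) = c • prodVec p a r := rfl

theorem prodVec_eq_add_partialT (p : M × ℝ) (a : TangentSpace 𝓘(ℝ, E) p.1) (r : ℝ) :
    prodVec p a r = prodVec p a 0 + r • partialT p := by
  rw [partialT, ← prodVec_smul, ← prodVec_add, smul_zero, add_zero, zero_add, mul_one]

theorem symplecticForm_swap (η : ∀ x : M, TangentSpace 𝓘(ℝ, E) x →L[ℝ] ℝ) (p : M × ℝ)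
    (u v : TangentSpace (symplModel E) p) :
    symplecticForm η p u v = - symplecticForm η p v u := by
  unfold symplecticForm extDerivOneForm; ring

variable [IsManifold 𝓘(ℝ, E) ∞ M] {n : ℕ}
  {C : ContactMetricStructure n E M}
  {gbar : ContMDiffRiemannianMetric (symplModel E) ∞ (E × ℝ)
    (fun p : M × ℝ => TangentSpace (symplModel E) p)}
  {J : ∀ p : M × ℝ, TangentSpace (symplModel E) p →L[ℝ] TangentSpace (symplModel E) p}

theorem prodVec_eq_add_reeb (C : ContactMetricStructure n E M) (p : M × ℝ)
    (a : TangentSpace 𝓘(ℝ, E) p.1) :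
    prodVec p a 0 = prodVec p (a - C.η p.1 a • C.ξ p.1) 0 + C.η p.1 a • prodVec p (C.ξ p.1) 0 := by
  rw [← prodVec_smul, ← prodVec_add, sub_add_cancel, mul_zero, add_zero]

theorem η_sub_reeb (C : ContactMetricStructure n E M) (x : M) (a : TangentSpace 𝓘(ℝ, E) x) :
    C.η x (a - C.η x a • C.ξ x) = 0 := by
  rw [map_sub, map_smul, C.η_ξ, smul_eq_mul, mul_one, sub_self]

/-! ### The values of `ḡ` on `ker η`, `∂_t` and `ξ` -/

namespace IsMetricSymplectization

theorem inner_eq_neg (hS : IsMetricSymplectization C gbar J) (p : M × ℝ)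
    (u v : TangentSpace (symplModel E) p) :
    gbar.inner p u v = - symplecticForm C.η p u (J p v) := by
  rw [← hS.compatible, hS.J_sq, map_neg, neg_neg]

/-- On `ker η` the endomorphism `J` is known to be `φ`, so `ḡ(u, b) = -ω(u, φ b)`; then `dη = g(·, φ
·)` and `φ² b = -b` bring back `g`. -/
theorem inner_horizontal (hS : IsMetricSymplectization C gbar J) (p : M × ℝ)
    (a b : TangentSpace 𝓘(ℝ, E) p.1) (r : ℝ) (hb : C.η p.1 b = 0) :
    gbar.inner p (prodVec p a r) (prodVec p b 0) = Real.exp (2 * p.2) * C.g.inner p.1 a b := by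
  rw [hS.inner_eq_neg, hS.agrees p b hb, symplecticForm_apply C.η C.contMDiff_η, η_φ, C.dη_eq,
    C.φ_sq, hb, zero_smul, add_zero, map_neg]
  ring

theorem inner_partialT (hS : IsMetricSymplectization C gbar J) (p : M × ℝ)
    (a : TangentSpace 𝓘(ℝ, E) p.1) (r : ℝ) :
    gbar.inner p (partialT p) (prodVec p a r) = r := by
  rw [prodVec_eq_add_partialT, map_add, map_smul, hS.orthogonal, hS.unit]
  simp

/-- The value of `J` on `ξ` is not prescribed, so it has to be found through `J ∂_t`. This vector
turns out to be a multiple `λ ξ`. Pairing it with `ξ` and with itself gives two equations for `λ`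
and `N = ḡ(ξ, ξ)`. -/
theorem inner_reeb (hS : IsMetricSymplectization C gbar J) (p : M × ℝ) :
    gbar.inner p (prodVec p (C.ξ p.1) 0) (prodVec p (C.ξ p.1) 0) = Real.exp (2 * p.2) ^ 2 := by
  have he := Real.exp_pos (2 * p.2)
  set N := gbar.inner p (prodVec p (C.ξ p.1) 0) (prodVec p (C.ξ p.1) 0)
  have hω : ∀ a r, gbar.inner p (prodVec p a r) (J p (partialT p)) =
      - (Real.exp (2 * p.2) * C.η p.1 a) := by
    intro a r
    rw [hS.compatible, partialT, symplecticForm_apply C.η C.contMDiff_η, C.dη_eq]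
    simp
  -- `J ∂_t` is tangent to the slice, because `ḡ(∂_t, J ∂_t) = ω(∂_t, ∂_t) = 0`.
  have hJ0 : J p (partialT p) = prodVec p (fstL p (J p (partialT p))) 0 := by
    have h1 := hS.inner_partialT p (fstL p (J p (partialT p))) (dt p (J p (partialT p)))
    rw [← prodVec_surj] at h1
    have h2 := hω 0 1
    rw [map_zero, mul_zero, neg_zero] at h2
    have h3 : dt p (J p (partialT p)) = 0 := h1.symm.trans h2
    conv_lhs => rw [prodVec_surj p (J p (partialT p)), h3]
  set c := fstL p (J p (partialT p))
  -- Let `b` be the `ker η` component of `c`. Then `ḡ(b, J ∂_t) = ω(b, ∂_t) = 0`, while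
  -- `inner_horizontal` evaluates the same product as `e^{2t} g(b, b)`.
  have hc0 : c - C.η p.1 c • C.ξ p.1 = 0 := by
    by_contra h
    have h1 := hω (c - C.η p.1 c • C.ξ p.1) 0
    have h2 := hS.inner_horizontal p c _ 0 (η_sub_reeb C p.1 c)
    rw [hJ0, gbar.symm, h2, η_sub_reeb, mul_zero, neg_zero] at h1
    have h3 := C.g.pos p.1 _ h
    rw [map_sub, map_smul, C.g_ξ, η_sub_reeb, smul_zero, sub_zero, C.g.symm] at h3
    exact (mul_pos he h3).ne' h1
  have hJ1 : J p (partialT p) = C.η p.1 c • prodVec p (C.ξ p.1) 0 := by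
    rw [hJ0, prodVec_eq_add_reeb C, hc0]
    exact zero_add _
  have e1 : C.η p.1 c * N = - Real.exp (2 * p.2) := by
    have := hω (C.ξ p.1) 0
    rw [hJ1, map_smul, C.η_ξ, mul_one] at this
    exact this
  -- `J` preserves the length of `∂_t`: `ḡ(J∂_t, J∂_t) = ω(J∂_t, ∂_t) = -ω(∂_t, J∂_t) = ḡ(∂_t,
  -- ∂_t)`.
  have e2 : - (Real.exp (2 * p.2) * C.η p.1 c) = 1 := by
    have h1 := hω c 0
    rw [← hJ0] at h1
    rw [← h1, hS.compatible, symplecticForm_swap, ← hS.compatible, hS.J_sq, map_neg, hS.unit,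
      neg_neg]
  -- With `λ = η(c)`: `N = (-e^{2t} λ) N = -e^{2t} (λ N) = e^{4t}`.
  nlinarith

/-- Every tangent vector splits along `∂_t`, `ξ` and `ker η`, and the preceding lemmas give the
products with each summand. The explicit metric can therefore replace the hypothetical one. -/
theorem inner_eq (hS : IsMetricSymplectization C gbar J) (p : M × ℝ)
    (u v : TangentSpace (symplModel E) p) : gbar.inner p u v = gbarInner C p u v := by
  have hξ : ∀ a r, gbar.inner p (prodVec p a r) (prodVec p (C.ξ p.1) 0) =
      Real.exp (2 * p.2) ^ 2 * C.η p.1 a := by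
    intro a r
    rw [gbar.symm, prodVec_eq_add_partialT p a, map_add, map_smul, gbar.symm p _ (partialT p),
      hS.orthogonal, prodVec_eq_add_reeb C p a, map_add, map_smul, hS.inner_reeb,
      hS.inner_horizontal p _ _ _ (η_sub_reeb C p.1 a), C.g.symm, C.g_ξ, η_sub_reeb]
    simp [mul_comm]
  rw [gbarInner_apply, prodVec_surj p u, prodVec_surj p v]
  simp only [fstL_prodVec, dt_prodVec]
  generalize fstL p u = a
  generalize fstL p v = b
  rw [prodVec_eq_add_partialT p b, map_add, map_smul, gbar.symm p _ (partialT p),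
    hS.inner_partialT, prodVec_eq_add_reeb C p b, map_add, map_smul, hξ,
    hS.inner_horizontal p _ _ _ (η_sub_reeb C p.1 b), map_sub, map_smul, C.g_ξ]
  simp only [smul_eq_mul]
  ring

end IsMetricSymplectization

end Unique

end ContactMetric

namespace ContactMetric

/-! ### The symplectization in charts -/

section RicciT

variable {E : Type*} [NormedAddCommGroup E] [NormedSpace ℝ E]
  {M : Type*} [TopologicalSpace M] [ChartedSpace E M] [IsManifold 𝓘(ℝ, E) ∞ M] {n : ℕ}
  (C : ContactMetricStructure n E M)

/-- The Reeb vector field, read in the chart at `x`. -/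
noncomputable def chartReeb (x : M) (y : E) : E :=
  (chartVec 𝓘(ℝ, E) x y).inverse (C.ξ ((extChartAt 𝓘(ℝ, E) x).symm y))

/-- The shape operator `u ↦ ∇_u ∂_t` of the slices in a chart: `(a, r) ↦ (a + η(a) ξ, 0)`. -/
noncomputable def chartShape (x : M) (z u : E × ℝ) : E × ℝ :=
  (u.1 + chartOneForm 𝓘(ℝ, E) C.η x z.1 u.1 • chartReeb C x z.1, 0)

variable {C}

theorem chartVec_chartReeb (x : M) {y : E} (hy : y ∈ (extChartAt 𝓘(ℝ, E) x).target) :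
    chartVec 𝓘(ℝ, E) x y (chartReeb C x y) = C.ξ ((extChartAt 𝓘(ℝ, E) x).symm y) :=
  ((isInvertible_chartVec x hy).inverse_apply_eq.1 rfl).symm

theorem chartTensor_chartReeb (x : M) {y : E} (hy : y ∈ (extChartAt 𝓘(ℝ, E) x).target) (a : E) :
    chartTensor 𝓘(ℝ, E) C.g.inner x y (chartReeb C x y) a = chartOneForm 𝓘(ℝ, E) C.η x y a := by
  change C.g.inner _ (chartVec 𝓘(ℝ, E) x y (chartReeb C x y)) (chartVec 𝓘(ℝ, E) x y a) = _
  rw [chartVec_chartReeb x hy, C.g.symm, C.g_ξ]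
  rfl

theorem chartOneForm_chartReeb (x : M) {y : E} (hy : y ∈ (extChartAt 𝓘(ℝ, E) x).target) :
    chartOneForm 𝓘(ℝ, E) C.η x y (chartReeb C x y) = 1 := by
  change C.η _ (chartVec 𝓘(ℝ, E) x y (chartReeb C x y)) = _
  rw [chartVec_chartReeb x hy, C.η_ξ]

theorem chartShape_chartShape (x : M) {z : E × ℝ} (hz : z.1 ∈ (extChartAt 𝓘(ℝ, E) x).target)
    (u : E × ℝ) : chartShape C x z (chartShape C x z u) =
      (u.1 + (3 * chartOneForm 𝓘(ℝ, E) C.η x z.1 u.1) • chartReeb C x z.1, 0) := by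
  simp only [chartShape, map_add, map_smul, chartOneForm_chartReeb x hz, smul_eq_mul, mul_one]
  refine Prod.ext ?_ rfl
  -- `A = id + η ⊗ ξ` on the slice and `η(ξ) = 1`, hence `A² = id + 3 η ⊗ ξ`.
  module

/-! ### Curvature of the symplectization in the direction of `∂_t` -/

variable {gbar : ContMDiffRiemannianMetric (symplModel E) ∞ (E × ℝ)
    (fun p : M × ℝ => TangentSpace (symplModel E) p)}
  {J : ∀ p : M × ℝ, TangentSpace (symplModel E) p →L[ℝ] TangentSpace (symplModel E) p}

namespace IsMetricSymplectization

theorem chartTensor_apply (hS : IsMetricSymplectization C gbar J) (p : M × ℝ) {z : E × ℝ}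
    (hz : z.1 ∈ (extChartAt 𝓘(ℝ, E) p.1).target) (u v : E × ℝ) :
    chartTensor (symplModel E) gbar.inner p z u v = u.2 * v.2
      + Real.exp (2 * z.2) * chartTensor 𝓘(ℝ, E) C.g.inner p.1 z.1 u.1 v.1
      + Real.exp (2 * z.2) * (Real.exp (2 * z.2) - 1) *
        (chartOneForm 𝓘(ℝ, E) C.η p.1 z.1 u.1 * chartOneForm 𝓘(ℝ, E) C.η p.1 z.1 v.1) := by
  refine (hS.inner_eq _ (chartVec (symplModel E) p z u) (chartVec (symplModel E) p z v)).trans ?_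
  rw [chartVec_prod p hz]
  rfl

/-- With `a = g(u, v)`, `b = η(u)`, `c = η(v)`, the `t`-derivative is `2e^{2t} a + (4e^{4t} -
2e^{2t}) b c`. This is twice the value of `ḡ` after `u` is replaced by `u + b ξ`, since that changes
`a` to `a + b c` and `b` to `2b`. -/
theorem fderiv_chartTensor_partialT (hS : IsMetricSymplectization C gbar J) (p : M × ℝ)
    {z : E × ℝ} (hz : z.1 ∈ (extChartAt 𝓘(ℝ, E) p.1).target)
    (hd : DifferentiableAt ℝ (chartTensor (symplModel E) gbar.inner p) z) (u v : E × ℝ) :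
    fderiv ℝ (chartTensor (symplModel E) gbar.inner p) z (0, 1) u v =
      2 * chartTensor (symplModel E) gbar.inner p z (chartShape C p.1 z u) v := by
  have h1 : HasFDerivAt (fun y => chartTensor (symplModel E) gbar.inner p y u v)
      (((fderiv ℝ (chartTensor (symplModel E) gbar.inner p) z).flip u).flip v) z := by
    simpa using (hd.hasFDerivAt.clm_apply (hasFDerivAt_const u z)).clm_apply (hasFDerivAt_const v z)
  -- Restriction to the line through `z` in the direction `∂_t` fixes the point of `M`, so only the
  -- exponentials vary.
  have h2 : HasDerivAt (fun s : ℝ => z + s • ((0, 1) : E × ℝ)) (0, 1) 0 := by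
    simpa using ((hasDerivAt_id (0 : ℝ)).smul_const ((0, 1) : E × ℝ)).const_add z
  have h3 := HasFDerivAt.comp_hasDerivAt_of_eq (0 : ℝ) h1 h2 (by simp)
  have h4 : HasDerivAt (fun s : ℝ => Real.exp (2 * (z.2 + s))) (Real.exp (2 * z.2) * 2) 0 := by
    simpa using (((hasDerivAt_id (0 : ℝ)).const_add z.2).const_mul 2).exp
  set a := chartTensor 𝓘(ℝ, E) C.g.inner p.1 z.1 u.1 v.1 with ha
  set b := chartOneForm 𝓘(ℝ, E) C.η p.1 z.1 u.1 with hb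
  set c := chartOneForm 𝓘(ℝ, E) C.η p.1 z.1 v.1 with hc
  have h5 := ((h4.mul_const a).const_add (u.2 * v.2)).add
    ((h4.mul (h4.sub_const 1)).mul_const (b * c))
  have h6 : (fun y => chartTensor (symplModel E) gbar.inner p y u v) ∘
      (fun s : ℝ => z + s • ((0, 1) : E × ℝ)) = fun s => u.2 * v.2 + Real.exp (2 * (z.2 + s)) * a
        + Real.exp (2 * (z.2 + s)) * (Real.exp (2 * (z.2 + s)) - 1) * (b * c) := by
    funext s
    have e1 : (z + s • ((0, 1) : E × ℝ)).1 = z.1 := by simp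
    have e2 : (z + s • ((0, 1) : E × ℝ)).2 = z.2 + s := by simp
    have := hS.chartTensor_apply p (z := z + s • ((0, 1) : E × ℝ)) (e1 ▸ hz) u v
    rw [e1, e2] at this
    exact this
  rw [h6] at h3
  refine (h3.unique h5).trans ?_
  rw [hS.chartTensor_apply p hz]
  simp only [chartShape, map_add, map_smul, add_apply, smul_apply, chartTensor_chartReeb p.1 hz,
    chartOneForm_chartReeb p.1 hz, smul_eq_mul, ← ha, ← hb, ← hc]
  simp only [add_zero]
  ring

theorem riemannCurvature_partialT [FiniteDimensional ℝ E] (hS : IsMetricSymplectization C gbar J)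
    (p : M × ℝ) (u : E × ℝ) :
    riemannCurvature (chartTensor (symplModel E) gbar.inner p) (extChartAt (symplModel E) p p) u
      (0, 1) (0, 1) = - chartShape C p.1 (extChartAt (symplModel E) p p)
        (chartShape C p.1 (extChartAt (symplModel E) p p) u) := by
  have hd : ∀ᶠ z in 𝓝 (extChartAt (symplModel E) p p),
      DifferentiableAt ℝ (chartTensor (symplModel E) gbar.inner p) z :=
    -- Finite smoothness at a point persists nearby; the order is lowered from `∞` to `1` to use
    -- this.
    (((contDiffAt_chartTensor gbar p).of_le (m := 1) (by simp)).eventually (by simp)).mono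
      fun z hz => hz.differentiableAt (by simp)
  have hU : ∀ᶠ z in 𝓝 (extChartAt (symplModel E) p p),
      z.1 ∈ (extChartAt 𝓘(ℝ, E) p.1).target :=
    continuous_fst.continuousAt.eventually (extChartAt_target_mem_nhds (I := 𝓘(ℝ, E)) p.1)
  refine riemannCurvature_of_dual_const (τ := ContinuousLinearMap.snd ℝ E ℝ) hd ?_
    (Eventually.of_forall fun z => chartTensor_symm gbar p z) ?_ (chartShape C p.1) ?_ ?_ u
  · filter_upwards [hU] with z hz
    ext v <;> rw [ContinuousLinearMap.comp_apply, hS.chartTensor_apply p hz] <;> simp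
  · filter_upwards [extChartAt_target_mem_nhds (I := symplModel E) p] with z hz
    exact isInvertible_of_pos (chartTensor_pos gbar p hz)
  · filter_upwards [hd, hU] with z h1 h2 u
    refine ContinuousLinearMap.ext fun v => ?_
    rw [smul_apply, hS.fderiv_chartTensor_partialT p h2 h1, smul_eq_mul]
    ring
  -- `chartShape` depends on `z` only through `z.1`, which is constant along `∂_t`.
  · intro u
    exact Eventually.of_forall fun s => by simp [chartShape]

theorem ricci_partialT [FiniteDimensional ℝ E] (hdim : Module.finrank ℝ E = 2 * n + 1)
    (hS : IsMetricSymplectization C gbar J) (p : M × ℝ) :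
    ricci gbar p (partialT p) (partialT p) = -(2 * (n : ℝ) + 4) := by
  set y := extChartAt 𝓘(ℝ, E) p.1 p.1
  have hyt : y ∈ (extChartAt 𝓘(ℝ, E) p.1).target := mem_extChartAt_target p.1
  let fst : E × ℝ →ₗ[ℝ] E := LinearMap.fst ℝ E ℝ
  let inl : E →ₗ[ℝ] E × ℝ := LinearMap.inl ℝ E ℝ
  let η : E →ₗ[ℝ] ℝ := (chartOneForm 𝓘(ℝ, E) C.η p.1 y : E →L[ℝ] ℝ)
  let L : E × ℝ →ₗ[ℝ] E × ℝ :=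
    -(inl ∘ₗ fst + (3 : ℝ) • (η ∘ₗ fst).smulRight (inl (chartReeb C p.1 y)))
  have hL : ∀ u, riemannCurvature (chartTensor (symplModel E) gbar.inner p)
      (extChartAt (symplModel E) p p) u (0, 1) (0, 1) = L u := by
    intro u
    rw [hS.riemannCurvature_partialT, extChartAt_prod_self, chartShape_chartShape _ hyt]
    simp [L, inl, fst, η, mul_smul]
    rfl
  have htr : LinearMap.trace ℝ (E × ℝ) L = -(2 * (n : ℝ) + 4) := by
    -- The projection onto the slice has trace `dim E = 2n + 1`, by cyclicity. The rank-one term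
    -- contributes `3 η(ξ) = 3`, for a total of `2n + 4`.
    have h1 : LinearMap.trace ℝ (E × ℝ) (inl ∘ₗ fst) = 2 * n + 1 := by
      rw [LinearMap.trace_comp_comm', LinearMap.fst_comp_inl, LinearMap.trace_id, hdim]
      push_cast; ring
    have h2 : η (fst (inl (chartReeb C p.1 y))) = 1 := chartOneForm_chartReeb p.1 hyt
    simp only [L, map_neg, map_add, map_smul, h1, LinearMap.trace_smulRight,
      LinearMap.comp_apply, h2, smul_eq_mul]
    ring
  rw [← htr, ← sum_coord_eq_trace]
  change ∑ i, (Module.finBasis ℝ (E × ℝ)).coord i (riemannCurvature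
    (chartTensor (symplModel E) gbar.inner p) (extChartAt (symplModel E) p p)
    (Module.finBasis ℝ (E × ℝ) i) (0, 1) (0, 1)) = _
  exact Finset.sum_congr rfl fun i _ => congrArg _ (hL _)

end IsMetricSymplectization

end RicciT

end ContactMetric

theorem corollary1p1 {n : ℕ}
    {E : Type*} [NormedAddCommGroup E] [NormedSpace ℝ E] [FiniteDimensional ℝ E]
    (hdim : Module.finrank ℝ E = 2 * n + 1)
    {M : Type*} [TopologicalSpace M] [ChartedSpace E M] [IsManifold 𝓘(ℝ, E) ∞ M] [Nonempty M]
    (C : ContactMetric.ContactMetricStructure n E M)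
    (gbar : Bundle.ContMDiffRiemannianMetric (ContactMetric.symplModel E) ∞ (E × ℝ)
      (fun p : M × ℝ => TangentSpace (ContactMetric.symplModel E) p))
    (J : ∀ p : M × ℝ, TangentSpace (ContactMetric.symplModel E) p →L[ℝ]
      TangentSpace (ContactMetric.symplModel E) p)
    (hS : ContactMetric.IsMetricSymplectization C gbar J) :
    (¬ ∀ (p : M × ℝ) (v : TangentSpace (ContactMetric.symplModel E) p),
        0 ≤ ContactMetric.ricci gbar p v v) ∧
      ∀ p : M × ℝ,
        ContactMetric.ricci gbar p (ContactMetric.partialT p) (ContactMetric.partialT p)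
          = -(2 * (n : ℝ) + 4) := by
  refine ⟨fun h => ?_, hS.ricci_partialT hdim⟩
  obtain ⟨x⟩ := ‹Nonempty M›
  have h1 := h (x, 0) (ContactMetric.partialT (x, 0))
  rw [hS.ricci_partialT hdim] at h1
  have : (0 : ℝ) ≤ n := n.cast_nonneg
  linarith
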